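/- For integers $n \ge 3$ and $1 \le k \le n/2$ let the generalised Petersen graph $P(n,k)$ be the simple graph with vertex set $\{a_i, b_i : 0 \le i \le n-1\}$ and edge set $\{a_i a_{i+1},\ a_i b_i,\ b_i b_{i+k} : 0 \le i \le n-1\}$, subscripts being taken modulo $n$. A graph is called a Cayley graph if it is isomorphic to $\mathrm{Cay}(\Gamma,S)$ for some group $\Gamma$ and some symmetric subset $S=S^{-1}\subseteq\Gamma$ with $1\notin S$, that is, to the graph with vertex set $\Gamma$ in which $u$ and $v$ are adjacent if and only if $u^{-1}v\in S$. For a positive integer $N$ let $A(N)$ be the number of isomorphism classes of generalised Petersen graphs $P(n,k)$ with $n \le N$, and let $B(N)$ be the number of those isomorphism classes whose members are Cayley graphs. Then $$\lim_{N\to\infty} \frac{B(N)}{A(N)} = 0 .$$ In fact, there is a constant $c>0$ such that $$\frac{B(N)}{A(N)} < c\,\frac{\log N}{N}$$ for all sufficiently large integers $N$. -/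

import Mathlib

open Filter Topology

/-- The (oriented) edges `a_i a_{i+1}`, `a_i b_i`, `b_i b_{i+k}` with subscripts modulo `n`, where
`a_i` is `Sum.inl i` and `b_i` is `Sum.inr i`. -/
def petersenRel (n k : ℕ) : ZMod n ⊕ ZMod n → ZMod n ⊕ ZMod n → Prop
  | Sum.inl i, Sum.inl j => j = i + 1
  | Sum.inl i, Sum.inr j => j = i
  | Sum.inr i, Sum.inr j => j = i + (k : ZMod n)
  | Sum.inr _, Sum.inl _ => False

/-- The graph `P(n, k)`: the undirected simple graph with the edges above. -/
def genPetersen (n k : ℕ) : SimpleGraph (ZMod n ⊕ ZMod n) :=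
  SimpleGraph.fromRel (petersenRel n k)

/-- `P(n, k)` is a generalised Petersen graph for `n ≥ 3`, `k ≥ 1` and `k ≤ n / 2`. -/
structure PetersenParam where
  /-- the length of the outer cycle -/
  n : ℕ
  /-- the step of the inner edges -/
  k : ℕ
  three_le_n : 3 ≤ n
  one_le_k : 1 ≤ k
  two_mul_k_le : 2 * k ≤ n

/-- The generalised Petersen graph with given parameters. -/
def PetersenParam.graph (p : PetersenParam) : SimpleGraph (ZMod p.n ⊕ ZMod p.n) :=
  genPetersen p.n p.k

/-- Two parameter pairs are equivalent if their graphs are isomorphic. -/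
instance PetersenParam.isoSetoid : Setoid PetersenParam where
  r p q := Nonempty (p.graph ≃g q.graph)
  iseqv :=
    { refl := fun _ => ⟨SimpleGraph.Iso.refl⟩
      symm := fun ⟨e⟩ => ⟨e.symm⟩
      trans := fun ⟨e⟩ ⟨f⟩ => ⟨e.trans f⟩ }

/-- A graph is a Cayley graph if it is isomorphic to `Cay(Γ, S)` for some group `Γ` and some
symmetric set `S` with `1 ∉ S`. (Such an `S` generates `Γ` exactly when the graph is connected.) -/
def IsCayleyGraph.{u} {V : Type u} (G : SimpleGraph V) : Prop :=
  ∃ (Γ : Type u) (_ : Group Γ) (S : Set Γ),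
    (∀ g ∈ S, g⁻¹ ∈ S) ∧ (1 : Γ) ∉ S ∧ Nonempty (G ≃g SimpleGraph.mulCayley S)

/-- The isomorphism classes of the generalised Petersen graphs `P(n, k)` with `n ≤ N`. -/
def petersenClasses (N : ℕ) : Set (Quotient PetersenParam.isoSetoid) :=
  (fun p => Quotient.mk _ p) '' {p : PetersenParam | p.n ≤ N}

/-- The isomorphism classes of those `P(n, k)` with `n ≤ N` that are Cayley graphs. -/
def cayleyPetersenClasses (N : ℕ) : Set (Quotient PetersenParam.isoSetoid) :=
  (fun p => Quotient.mk _ p) '' {p : PetersenParam | p.n ≤ N ∧ IsCayleyGraph p.graph}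

theorem petersenClasses_finite (N : ℕ) : (petersenClasses N).Finite := by
  refine Set.Finite.image _ (Set.Finite.of_finite_image (f := fun p => (p.n, p.k)) ?_ ?_)
  · refine ((Set.finite_Iic N).prod (Set.finite_Iic N)).subset ?_
    rintro _ ⟨p, hp, rfl⟩
    have h := p.two_mul_k_le
    simp only [Set.mem_ofPred_eq] at hp
    simp only [Set.mem_prod, Set.mem_Iic]
    omega
  · rintro ⟨n, k, _, _, _⟩ _ ⟨n', k', _, _, _⟩ _ h
    simp only [Prod.mk.injEq] at h
    obtain ⟨rfl, rfl⟩ := h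
    rfl

/-- `A(N)`: the number of generalised Petersen graphs with `n ≤ N`, up to isomorphism. -/
noncomputable def petersenCount (N : ℕ) : ℕ := (petersenClasses N).ncard

/-- `B(N)`: the number of those that are Cayley graphs, up to isomorphism. -/
noncomputable def cayleyPetersenCount (N : ℕ) : ℕ := (cayleyPetersenClasses N).ncard

/-- The ratio `B(N) / A(N)` has a non-zero denominator for `N ≥ 3`. -/
theorem petersenCount_pos {N : ℕ} (hN : 3 ≤ N) : 0 < petersenCount N :=
  (Set.ncard_pos (petersenClasses_finite N)).2
    ⟨_, ⟨3, 1, le_rfl, le_rfl, by norm_num⟩, hN, rfl⟩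

/-!
Call `(n, k)` generic if `x + k y ≡ 0 mod n` has no non-zero solution with `|x|, |y| ≤ 8`. For each
`n`, only a bounded number of the `k ≤ n / 2` are not generic (`card_not_generic_le`), so these are
negligible both against `A(N)`, which is of order `N²`, and against the bound `N log N` for `B(N)`.

For generic parameters, walks of length at most `8` lift to an infinite graph made of two copies
of `ℤ²`, and a closed walk lifts to a closed walk. There, an edge of a layer and the spoke at one of
its ends lie on a common octagon, while the two edges of a layer at a vertex do not
(`lattice_no_octagon`). Octagons therefore tell spokes from other edges (`flat_iff`), every
isomorphism between generic `P(n, k)` and `P(n, l)` maps spokes to spokes, and following it along the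
outer cycle shows that `k ≡ ±l` if it preserves the layers and `k l ≡ ±1` if it exchanges them, modulo
`n` (`step_of_iso`).

Hence at most four generic parameters share an isomorphism class, so that `A(N)` is at least a
constant times `N²` (`sq_le_petersenCount`). A Cayley graph is vertex-transitive, so a generic
`P(n, k)` that is a Cayley graph has an automorphism exchanging the layers, and `k² ≡ ±1 mod n`. This
congruence has at most `4 d(n)` solutions, `d(n)` being the number of divisors of `n`
(`card_sq_eq_one_le`, `card_sq_eq_neg_one_le`), and the sum of `d(n)` over `n ≤ N` is at most
`N (1 + log N)`, which bounds `B(N)` (`cayleyPetersenCount_le`).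
-/

/-! ### Adjacency in generalised Petersen graphs -/

namespace genPetersen

/-- The pair `(n, k)` is generic if the lattice `{(x, y) ∈ ℤ² : x + k y ≡ 0 mod n}` has no non-zero
vector with both coordinates at most `8` in absolute value. Locally, `P(n, k)` then looks like the
infinite graph `latticeNbrs`. -/
def Generic (n k : ℕ) : Prop :=
  ∀ x y : ℤ, |x| ≤ 8 → |y| ≤ 8 → ((x + y * k : ℤ) : ZMod n) = 0 → x = 0 ∧ y = 0

/-- The vertices of `P(n, k)` by layer: `a_i` for `s = false` and `b_i` for `s = true`. -/
def vert {n : ℕ} (s : Bool) (i : ZMod n) : ZMod n ⊕ ZMod n :=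
  bif s then Sum.inr i else Sum.inl i

/-- The index difference along the edges inside a layer: `1` for the outer cycle, `k` for the inner
edges. -/
def step (n k : ℕ) (s : Bool) : ZMod n := bif s then (k : ZMod n) else 1

theorem vert_inj {n : ℕ} {s t : Bool} {i j : ZMod n} : vert s i = vert t j ↔ s = t ∧ i = j := by
  cases s <;> cases t <;> simp [vert]

theorem exists_vert {n : ℕ} (v : ZMod n ⊕ ZMod n) : ∃ s i, v = vert s i := by
  rcases v with i | i
  exacts [⟨false, i, rfl⟩, ⟨true, i, rfl⟩]

theorem Generic.one_ne_zero {n k : ℕ} (h : Generic n k) : (1 : ZMod n) ≠ 0 := fun h0 => by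
  simpa using h 1 0 (by norm_num) (by norm_num) (by simpa using h0)

theorem Generic.step_ne_zero {n k : ℕ} (h : Generic n k) (s : Bool) : step n k s ≠ 0 := by
  cases s
  · exact h.one_ne_zero
  · intro h0
    simpa using h 0 1 (by norm_num) (by norm_num) (by simpa [step] using h0)

theorem Generic.two_step_ne_zero {n k : ℕ} (h : Generic n k) (s : Bool) :
    step n k s + step n k s ≠ 0 := by
  cases s <;> intro h0 <;> simp only [step, cond_true, cond_false] at h0
  · simpa using h 2 0 (by norm_num) (by norm_num) (by push_cast; linear_combination h0)
  · simpa using h 0 2 (by norm_num) (by norm_num) (by push_cast; linear_combination h0)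

theorem adj_vert_iff {n k : ℕ} (h : Generic n k) (s : Bool) (i : ZMod n) (w : ZMod n ⊕ ZMod n) :
    (genPetersen n k).Adj (vert s i) w ↔
      w = vert s (i + step n k s) ∨ w = vert s (i - step n k s) ∨ w = vert (!s) i := by
  have h1 := h.step_ne_zero s
  obtain ⟨t, j, rfl⟩ := exists_vert w
  simp only [genPetersen, SimpleGraph.fromRel_adj, Ne, vert_inj]
  cases s <;> cases t <;> simp [vert, petersenRel, step] at h1 ⊢
  · constructor
    · rintro ⟨-, h | h⟩
      · exact Or.inl h
      · exact Or.inr (by rw [h]; ring)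
    · rintro (h | h) <;> subst h
      · exact ⟨by simpa using h1, Or.inl rfl⟩
      · exact ⟨fun e => h1 (by linear_combination e), Or.inr (by ring)⟩
  · exact eq_comm
  · constructor
    · rintro ⟨-, h | h⟩
      · exact Or.inl h
      · exact Or.inr (by rw [h]; ring)
    · rintro (h | h) <;> subst h
      · exact ⟨by simpa using h1, Or.inl rfl⟩
      · exact ⟨fun e => h1 (by linear_combination e), Or.inr (by ring)⟩

/-! ### Octagons -/

/-- There is a closed walk of length `8` without backtracking that has `u, v, w` as consecutive
vertices; the condition `u ≠ w` is left out. -/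
def InOctagon {V : Type*} (G : SimpleGraph V) (u v w : V) : Prop :=
  ∃ x₁ x₂ x₃ x₄ x₅ : V, G.Adj v w ∧ G.Adj w x₁ ∧ G.Adj x₁ x₂ ∧ G.Adj x₂ x₃ ∧ G.Adj x₃ x₄ ∧
    G.Adj x₄ x₅ ∧ G.Adj x₅ u ∧ G.Adj u v ∧
    v ≠ x₁ ∧ w ≠ x₂ ∧ x₁ ≠ x₃ ∧ x₂ ≠ x₄ ∧ x₃ ≠ x₅ ∧ x₄ ≠ u ∧ x₅ ≠ v

/-- Two edges `vu` and `vw` that lie on no common octagon. -/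
def Flat {V : Type*} (G : SimpleGraph V) (u v w : V) : Prop :=
  G.Adj v u ∧ G.Adj v w ∧ u ≠ w ∧ ¬ InOctagon G u v w

theorem InOctagon.symm {V : Type*} {G : SimpleGraph V} {u v w : V} (h : InOctagon G u v w) :
    InOctagon G w v u := by
  obtain ⟨x₁, x₂, x₃, x₄, x₅, h1, h2, h3, h4, h5, h6, h7, h8, n1, n2, n3, n4, n5, n6, n7⟩ := h
  exact ⟨x₅, x₄, x₃, x₂, x₁, h8.symm, h7.symm, h6.symm, h5.symm, h4.symm, h3.symm, h2.symm,
    h1.symm, n7.symm, n6.symm, n5.symm, n4.symm, n3.symm, n2.symm, n1.symm⟩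

theorem InOctagon.map {V W : Type*} {G : SimpleGraph V} {H : SimpleGraph W} (e : G ≃g H)
    {u v w : V} (h : InOctagon G u v w) : InOctagon H (e u) (e v) (e w) := by
  obtain ⟨x₁, x₂, x₃, x₄, x₅, h⟩ := h
  refine ⟨e x₁, e x₂, e x₃, e x₄, e x₅, ?_⟩
  simpa only [e.map_adj_iff, e.injective.ne_iff] using h

theorem Flat.map {V W : Type*} {G : SimpleGraph V} {H : SimpleGraph W} (e : G ≃g H)
    {u v w : V} (h : Flat G u v w) : Flat H (e u) (e v) (e w) := by
  obtain ⟨h1, h2, h3, h4⟩ := h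
  refine ⟨e.map_adj_iff.2 h1, e.map_adj_iff.2 h2, e.injective.ne h3, fun h => h4 ?_⟩
  simpa using h.map e.symm

/-- The neighbours in the infinite cover of all `P(n, k)`: two copies of `ℤ²`, one joined along the
first coordinate and the other along the second, with a spoke at each point of `ℤ²`. -/
def latticeNbrs : Bool × ℤ × ℤ → List (Bool × ℤ × ℤ)
  | (false, x, y) => [(false, x + 1, y), (false, x - 1, y), (true, x, y)]
  | (true, x, y) => [(true, x, y + 1), (true, x, y - 1), (false, x, y)]

/-- The vertex of `P(n, k)` below a vertex of the cover, `c` being the index below the origin. -/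
def proj {n : ℕ} (k : ℕ) (c : ZMod n) (p : Bool × ℤ × ℤ) : ZMod n ⊕ ZMod n :=
  vert p.1 (c + ((p.2.1 + p.2.2 * k : ℤ) : ZMod n))

theorem exists_lift_adj {n k : ℕ} (h : Generic n k) (c : ZMod n) (p : Bool × ℤ × ℤ)
    (w : ZMod n ⊕ ZMod n) (hw : (genPetersen n k).Adj (proj k c p) w) :
    ∃ q ∈ latticeNbrs p, w = proj k c q := by
  obtain ⟨s, x, y⟩ := p
  rw [proj, adj_vert_iff h] at hw
  cases s <;> simp only [latticeNbrs, List.mem_cons, List.not_mem_nil, or_false, exists_eq_or_imp,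
    exists_eq_left, proj] <;> refine hw.imp ?_ (Or.imp ?_ ?_) <;> rintro rfl <;>
    simp only [step, vert_inj, cond_true, cond_false, true_and, Bool.not_true, Bool.not_false] <;>
    push_cast <;> ring

theorem lattice_bound (p q : Bool × ℤ × ℤ) (h : q ∈ latticeNbrs p) :
    |q.2.1| ≤ |p.2.1| + 1 ∧ |q.2.2| ≤ |p.2.2| + 1 := by
  obtain ⟨s, x, y⟩ := p
  cases s <;> simp only [latticeNbrs, List.mem_cons, List.not_mem_nil, or_false] at h <;>
    rcases h with rfl | rfl | rfl <;> simp only [] <;> grind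

/-- The cover has no octagon through two edges of the same layer. Such an octagon would have at most
four spokes; the parts between the spokes are straight, and their displacements have to cancel in
both coordinates, so that there are four of length one. -/
theorem lattice_no_octagon (s : Bool) (u w : Bool × ℤ × ℤ)
    (hu : u = bif s then (true, 0, -1) else (false, -1, 0))
    (hw : w = bif s then (true, 0, 1) else (false, 1, 0)) :
    ∀ x₁ ∈ latticeNbrs w, (s, 0, 0) ≠ x₁ → ∀ x₂ ∈ latticeNbrs x₁, w ≠ x₂ →
    ∀ x₃ ∈ latticeNbrs x₂, x₁ ≠ x₃ → ∀ x₄ ∈ latticeNbrs x₃, x₂ ≠ x₄ →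
    ∀ x₅ ∈ latticeNbrs x₄, x₃ ≠ x₅ → u ∈ latticeNbrs x₅ → x₄ ≠ u → False := by
  subst hu hw
  cases s <;> decide +kernel

theorem not_inOctagon {n k : ℕ} (h : Generic n k) (s : Bool) (i : ZMod n) :
    ¬ InOctagon (genPetersen n k) (vert s (i - step n k s)) (vert s i)
      (vert s (i + step n k s)) := by
  rintro ⟨x₁, x₂, x₃, x₄, x₅, -, h2, h3, h4, h5, h6, h7, -, n1, n2, n3, n4, n5, n6, -⟩
  obtain ⟨u, hu⟩ : ∃ u : Bool × ℤ × ℤ, u = bif s then (true, 0, -1) else (false, -1, 0) := ⟨_, rfl⟩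
  obtain ⟨w, hw⟩ : ∃ w : Bool × ℤ × ℤ, w = bif s then (true, 0, 1) else (false, 1, 0) := ⟨_, rfl⟩
  have ev : vert s i = proj k i (s, 0, 0) := by simp [proj]
  have eu : vert s (i - step n k s) = proj k i u := by
    subst hu; cases s <;> simp [proj, step, vert_inj] <;> ring
  have ew : vert s (i + step n k s) = proj k i w := by
    subst hw; cases s <;> simp [proj, step]
  have bw : |w.2.1| ≤ 1 ∧ |w.2.2| ≤ 1 := by subst hw; cases s <;> simp
  have bu : |u.2.1| ≤ 1 ∧ |u.2.2| ≤ 1 := by subst hu; cases s <;> simp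
  rw [ev] at n1
  rw [ew] at n2 h2
  rw [eu] at h7 n6
  obtain ⟨p₁, m1, rfl⟩ := exists_lift_adj h i _ _ h2
  obtain ⟨p₂, m2, rfl⟩ := exists_lift_adj h i _ _ h3
  obtain ⟨p₃, m3, rfl⟩ := exists_lift_adj h i _ _ h4
  obtain ⟨p₄, m4, rfl⟩ := exists_lift_adj h i _ _ h5
  obtain ⟨p₅, m5, rfl⟩ := exists_lift_adj h i _ _ h6
  obtain ⟨p₆, m6, e⟩ := exists_lift_adj h i _ _ h7
  have b1 := lattice_bound _ _ m1
  have b2 := lattice_bound _ _ m2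
  have b3 := lattice_bound _ _ m3
  have b4 := lattice_bound _ _ m4
  have b5 := lattice_bound _ _ m5
  have b6 := lattice_bound _ _ m6
  -- The lifted walk ends above its starting point, and close to it, so genericity closes it up.
  have e6 : u = p₆ := by
    simp only [proj, vert_inj] at e
    have := h (u.2.1 - p₆.2.1) (u.2.2 - p₆.2.2) (by grind) (by grind)
      (by have := e.2; push_cast at this ⊢; linear_combination this)
    exact Prod.ext e.1 (Prod.ext (by linarith [this.1]) (by linarith [this.2]))
  subst e6
  exact lattice_no_octagon s u w hu hw p₁ m1 (fun e => n1 (e ▸ rfl)) p₂ m2 (fun e => n2 (e ▸ rfl))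
    p₃ m3 (fun e => n3 (e ▸ rfl)) p₄ m4 (fun e => n4 (e ▸ rfl)) p₅ m5 (fun e => n5 (e ▸ rfl)) m6
    (fun e => n6 (e ▸ rfl))

theorem inOctagon_spoke {n k : ℕ} (h : Generic n k) (s : Bool) (i d : ZMod n)
    (hd : d = step n k s ∨ d = -step n k s) :
    InOctagon (genPetersen n k) (vert s (i + d)) (vert s i) (vert (!s) i) := by
  have h1 := h.step_ne_zero s
  have h2 := h.step_ne_zero (!s)
  have hd0 : d ≠ 0 := by rcases hd with rfl | rfl <;> simpa
  refine ⟨vert (!s) (i + step n k (!s)), vert s (i + step n k (!s)),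
    vert s (i + step n k (!s) + d), vert (!s) (i + step n k (!s) + d), vert (!s) (i + d), ?_⟩
  simp only [adj_vert_iff h, vert_inj, Ne, Bool.not_not]
  rcases hd with rfl | rfl <;>
    simp [h1, h2, sub_eq_add_neg, add_assoc, add_comm, add_left_comm]

theorem flat_iff {n k : ℕ} (h : Generic n k) (s : Bool) (i : ZMod n) (u w : ZMod n ⊕ ZMod n) :
    Flat (genPetersen n k) u (vert s i) w ↔
      ∃ d : ZMod n, (d = step n k s ∨ d = -step n k s) ∧ u = vert s (i - d) ∧
        w = vert s (i + d) := by
  have hp := inOctagon_spoke h s i _ (Or.inl rfl)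
  have hm := inOctagon_spoke h s i _ (Or.inr rfl)
  rw [← sub_eq_add_neg] at hm
  constructor
  · rintro ⟨h1, h2, h3, h4⟩
    rw [adj_vert_iff h] at h1 h2
    rcases h1 with rfl | rfl | rfl <;> rcases h2 with rfl | rfl | rfl
    · exact absurd rfl h3
    · exact ⟨_, Or.inr rfl, by rw [sub_neg_eq_add], by rw [sub_eq_add_neg]⟩
    · exact absurd hp h4
    · exact ⟨_, Or.inl rfl, rfl, rfl⟩
    · exact absurd rfl h3
    · exact absurd hm h4
    · exact absurd hp.symm h4
    · exact absurd hm.symm h4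
    · exact absurd rfl h3
  · have h2 := h.two_step_ne_zero s
    rintro ⟨d, rfl | rfl, rfl, rfl⟩
    · refine ⟨?_, ?_, ?_, not_inOctagon h s i⟩
      · simp [adj_vert_iff h]
      · simp [adj_vert_iff h]
      · rw [Ne, vert_inj]
        exact fun e => h2 (by linear_combination -e.2)
    · rw [sub_neg_eq_add, ← sub_eq_add_neg]
      refine ⟨?_, ?_, ?_, fun e => not_inOctagon h s i e.symm⟩
      · simp [adj_vert_iff h]
      · simp [adj_vert_iff h]
      · rw [Ne, vert_inj]
        exact fun e => h2 (by linear_combination e.2)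

/-! ### Isomorphisms between generic generalised Petersen graphs -/

theorem iso_outer {n k l : ℕ} (hk : Generic n k) (hl : Generic n l)
    (e : genPetersen n k ≃g genPetersen n l) {s : Bool} {j : ZMod n}
    (h0 : e (vert false 0) = vert s j) :
    ∃ d : ZMod n, (d = step n l s ∨ d = -step n l s) ∧
      ∀ i : ℕ, e (vert false (i : ZMod n)) = vert s (j + (i : ZMod n) * d) ∧
        e (vert false ((i + 1 : ℕ) : ZMod n)) = vert s (j + ((i + 1 : ℕ) : ZMod n) * d) := by
  have key (i : ZMod n) := ((flat_iff hk false i _ _).2 ⟨1, Or.inl rfl, rfl, rfl⟩).map e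
  have h1 := key 0
  rw [h0, flat_iff hl] at h1
  obtain ⟨d, hd, -, h1⟩ := h1
  refine ⟨d, hd, fun i => ?_⟩
  induction i with
  | zero => exact ⟨by simpa using h0, by simpa using h1⟩
  | succ i ih =>
    refine ⟨ih.2, ?_⟩
    have h2 := key ((i + 1 : ℕ) : ZMod n)
    rw [ih.2, flat_iff hl] at h2
    obtain ⟨d', -, h3, h4⟩ := h2
    have h5 : (((i + 1 : ℕ) : ZMod n) - 1) = (i : ZMod n) := by push_cast; ring
    rw [h5, ih.1, vert_inj] at h3
    have h6 : d' = d := by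
      have := h3.2
      push_cast at this
      linear_combination this
    have h7 : ((i + 1 + 1 : ℕ) : ZMod n) = ((i + 1 : ℕ) : ZMod n) + 1 := by push_cast; ring
    rw [h7, h4, h6, vert_inj]
    exact ⟨rfl, by push_cast; ring⟩

theorem iso_inner {n k l : ℕ} [NeZero n] (hk : Generic n k) (hl : Generic n l)
    (e : genPetersen n k ≃g genPetersen n l) {s : Bool} {j : ZMod n}
    (h0 : e (vert false 0) = vert s j) :
    ∃ d : ZMod n, (d = step n l s ∨ d = -step n l s) ∧
      ∀ i : ZMod n, e (vert true i) = vert (!s) (j + i * d) := by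
  obtain ⟨d, hd, h⟩ := iso_outer hk hl e h0
  have h' (i : ZMod n) : e (vert false i) = vert s (j + i * d) := by
    obtain ⟨i, rfl⟩ := ZMod.natCast_zmod_surjective i
    exact (h i).1
  refine ⟨d, hd, fun i => ?_⟩
  have ha : (genPetersen n l).Adj (e (vert false i)) (e (vert true i)) := by
    rw [e.map_adj_iff, adj_vert_iff hk]
    exact Or.inr (Or.inr rfl)
  have hne (i' : ZMod n) : e (vert true i) ≠ vert s (j + i' * d) := by
    rw [← h', e.injective.ne_iff, Ne, vert_inj]
    simp
  rw [h', adj_vert_iff hl] at ha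
  have hp := hne (i + 1)
  have hm := hne (i - 1)
  rw [show j + (i + 1) * d = j + i * d + d by ring] at hp
  rw [show j + (i - 1) * d = j + i * d - d by ring] at hm
  rcases hd with rfl | rfl
  · exact (ha.resolve_left hp).resolve_left hm
  · rw [← sub_eq_add_neg] at hp
    rw [sub_neg_eq_add] at hm
    exact (ha.resolve_left hm).resolve_left hp

/-- An isomorphism takes spokes to spokes. If it takes the outer cycle to the outer cycle, then the
inner steps agree up to sign; if it exchanges the two layers, then they are inverse up to sign. -/
theorem step_of_iso {n k l : ℕ} [NeZero n] (hk : Generic n k) (hl : Generic n l)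
    (e : genPetersen n k ≃g genPetersen n l) {s : Bool} {j : ZMod n}
    (h0 : e (vert false 0) = vert s j) :
    bif s then ((k : ZMod n) * l = 1 ∨ (k : ZMod n) * l = -1)
      else ((k : ZMod n) = l ∨ (k : ZMod n) = -l) := by
  obtain ⟨d, hd, h⟩ := iso_inner hk hl e h0
  have ha : (genPetersen n l).Adj (e (vert true 0)) (e (vert true k)) := by
    rw [e.map_adj_iff, adj_vert_iff hk]
    exact Or.inl (by simp [step])
  rw [h, h, adj_vert_iff hl] at ha
  simp only [vert_inj, true_and, zero_mul, add_zero] at ha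
  have hs : (!s) ≠ (!!s) := by cases s <;> simp
  have ha' : (k : ZMod n) * d = step n l (!s) ∨ (k : ZMod n) * d = -step n l (!s) := by
    rcases ha with ha | ha | ha
    · exact Or.inl (by linear_combination ha)
    · exact Or.inr (by linear_combination ha)
    · exact absurd ha.1 hs
  cases s <;> simp only [step, cond_true, cond_false, Bool.not_true, Bool.not_false] at hd ha' ⊢ <;>
    rcases hd with rfl | rfl <;> rcases ha' with ha' | ha'
  · exact Or.inl (by linear_combination ha')
  · exact Or.inr (by linear_combination ha')
  · exact Or.inr (by linear_combination -ha')
  · exact Or.inl (by linear_combination -ha')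
  · exact Or.inl (by linear_combination ha')
  · exact Or.inr (by linear_combination ha')
  · exact Or.inr (by linear_combination -ha')
  · exact Or.inl (by linear_combination -ha')

theorem step_of_nonempty_iso {n k l : ℕ} [NeZero n] (hk : Generic n k) (hl : Generic n l)
    (e : Nonempty (genPetersen n k ≃g genPetersen n l)) :
    ((k : ZMod n) = l ∨ (k : ZMod n) = -l) ∨ ((k : ZMod n) * l = 1 ∨ (k : ZMod n) * l = -1) := by
  obtain ⟨e⟩ := e
  obtain ⟨s, j, h0⟩ := exists_vert (e (vert false 0))
  have := step_of_iso hk hl e h0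
  cases s
  exacts [Or.inl this, Or.inr this]

end genPetersen

theorem IsCayleyGraph.exists_iso {V : Type*} {G : SimpleGraph V} (h : IsCayleyGraph G) (u v : V) :
    ∃ e : G ≃g G, e u = v := by
  obtain ⟨Γ, _, S, -, -, ⟨f⟩⟩ := h
  let t : SimpleGraph.mulCayley S ≃g SimpleGraph.mulCayley S :=
    ⟨Equiv.mulLeft (f v * (f u)⁻¹), by simp⟩
  exact ⟨(f.trans t).trans f.symm, by simp [t]⟩

/-- A Cayley graph has an automorphism that takes an outer vertex to an inner one, so it exchanges
the two layers. -/
theorem genPetersen.sq_of_isCayleyGraph {n k : ℕ} [NeZero n] (hk : Generic n k)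
    (h : IsCayleyGraph (genPetersen n k)) : (k : ZMod n) ^ 2 = 1 ∨ (k : ZMod n) ^ 2 = -1 := by
  obtain ⟨e, he⟩ := h.exists_iso (vert false 0) (vert true 0)
  simpa [sq] using step_of_iso hk hk e he

/-! ### Square roots of `1` and `-1` modulo `n` -/

/-- A root `k` of `k² = 1` is congruent to `-1` modulo `d = gcd (k + 1, n)` and to `1` modulo
`n / d`, which determines `2 k` modulo `n` in terms of the divisor `d`. -/
theorem card_sq_eq_one_le {n : ℕ} (hn : 0 < n) :
    {k ∈ Finset.range n | ((k : ℕ) : ZMod n) ^ 2 = 1}.card ≤ 2 * n.divisors.card := by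
  refine Finset.card_le_mul_card_image_of_maps_to (f := fun k => Nat.gcd (k + 1) n)
    (fun k _ => Nat.mem_divisors.2 ⟨Nat.gcd_dvd_right _ _, hn.ne'⟩) 2 fun d _ => ?_
  have key : ∀ k : ℕ, (k : ZMod n) ^ 2 = 1 → Nat.gcd (k + 1) n = d →
      (d : ℤ) ∣ k + 1 ∧ ∃ e : ℤ, (n : ℤ) = d * e ∧ e ∣ k - 1 := by
    intro k hk hd
    have hdn : d ∣ n := hd ▸ Nat.gcd_dvd_right _ _
    have hd0 : 0 < d := Nat.pos_of_dvd_of_pos hdn hn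
    obtain ⟨a, ha⟩ : d ∣ k + 1 := hd ▸ Nat.gcd_dvd_left _ _
    obtain ⟨e, he⟩ := hdn
    have hcop : Nat.Coprime a e := by
      have := hd
      rw [ha, he, Nat.gcd_mul_left] at this
      exact Nat.eq_of_mul_eq_mul_left hd0 (by simpa using this)
    have ha' : (k : ℤ) + 1 = d * a := by exact_mod_cast ha
    have he' : (n : ℤ) = d * e := by exact_mod_cast he
    refine ⟨⟨a, ha'⟩, e, he', ?_⟩
    have h1 : (n : ℤ) ∣ (k + 1) * (k - 1) := by
      rw [← ZMod.intCast_zmod_eq_zero_iff_dvd _ n]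
      push_cast
      linear_combination hk
    rw [ha', he', mul_assoc, mul_dvd_mul_iff_left (by exact_mod_cast hd0.ne')] at h1
    exact (Nat.isCoprime_iff_coprime.2 hcop).symm.dvd_of_dvd_mul_left h1
  have pair : ∀ k l : ℕ, (k : ZMod n) ^ 2 = 1 → Nat.gcd (k + 1) n = d →
      (l : ZMod n) ^ 2 = 1 → Nat.gcd (l + 1) n = d → (n : ℤ) ∣ 2 * (k - l) := by
    intro k l hk hkd hl hld
    obtain ⟨h1, e, he, h2⟩ := key k hk hkd
    obtain ⟨h3, e', he', h4⟩ := key l hl hld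
    have hd0 : (d : ℤ) ≠ 0 := by
      rintro h0
      rw [h0, zero_mul] at he
      omega
    obtain rfl : e = e' := mul_left_cancel₀ hd0 (he.symm.trans he')
    have h5 : (d : ℤ) ∣ k - l := by simpa using dvd_sub h1 h3
    have h6 : e ∣ (k : ℤ) - l := by simpa using dvd_sub h2 h4
    have h7 : (2 : ℤ) * (k - l) = (k + 1) * (k - l) - (k - l) * (k - 1) := by ring
    rw [h7, he]
    exact dvd_sub (mul_dvd_mul h1 h6) (mul_dvd_mul h5 h2)
  by_contra! hcard
  obtain ⟨x, y, z, hx, hy, hz, hxy, hxz, hyz⟩ := Finset.two_lt_card_iff.1 hcard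
  simp only [Finset.mem_filter, Finset.mem_range] at hx hy hz
  obtain ⟨a, ha⟩ := pair x y hx.1.2 hx.2 hy.1.2 hy.2
  obtain ⟨b, hb⟩ := pair y z hy.1.2 hy.2 hz.1.2 hz.2
  obtain ⟨c, hc⟩ := pair x z hx.1.2 hx.2 hz.1.2 hz.2
  -- Two distinct residues with the same double differ by `± n / 2`, so there are no three of them.
  have unit_of : ∀ u v : ℕ, ∀ t : ℤ, u < n → v < n → u ≠ v → 2 * ((u : ℤ) - v) = n * t →
      t = 1 ∨ t = -1 := by
    intro u v t hu hv huv h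
    have h1 : t < 2 := by
      by_contra! h1
      nlinarith
    have h2 : -2 < t := by
      by_contra! h1
      nlinarith
    have h3 : t ≠ 0 := by
      rintro rfl
      omega
    omega
  rcases unit_of x y a hx.1.1 hy.1.1 hxy ha with rfl | rfl <;>
  rcases unit_of y z b hy.1.1 hz.1.1 hyz hb with rfl | rfl <;>
  rcases unit_of x z c hx.1.1 hz.1.1 hxz hc with rfl | rfl <;> omega

theorem card_sq_eq_neg_one_le {n : ℕ} (hn : 0 < n) :
    {k ∈ Finset.range n | ((k : ℕ) : ZMod n) ^ 2 = -1}.card ≤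
      {k ∈ Finset.range n | ((k : ℕ) : ZMod n) ^ 2 = 1}.card := by
  have : NeZero n := ⟨hn.ne'⟩
  rcases Finset.eq_empty_or_nonempty {k ∈ Finset.range n | ((k : ℕ) : ZMod n) ^ 2 = -1}
    with h | ⟨c, hc⟩
  · simp [h]
  · simp only [Finset.mem_filter] at hc
    -- Multiplication by a fixed root of `-1` takes the roots of `-1` to roots of `1`.
    refine Finset.card_le_card_of_injOn (fun k => ((k : ZMod n) * c).val) ?_ ?_
    · intro k hk
      simp only [Finset.coe_filter, Set.mem_ofPred_eq, Finset.mem_range] at hk ⊢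
      refine ⟨ZMod.val_lt _, ?_⟩
      rw [ZMod.natCast_zmod_val, mul_pow, hk.2, hc.2]
      ring
    · intro k hk l hl h
      simp only [Finset.coe_filter, Set.mem_ofPred_eq, Finset.mem_range] at hk hl
      have h1 : (k : ZMod n) * c = l * c := ZMod.val_injective n h
      have h2 : (k : ZMod n) = l := by
        linear_combination (-c : ZMod n) * h1 + (k - l : ZMod n) * hc.2
      rw [ZMod.natCast_eq_natCast_iff] at h2
      exact Nat.ModEq.eq_of_lt_of_lt h2 hk.1 hl.1

theorem sum_card_divisors_le (N : ℕ) :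
    ((∑ n ∈ Finset.Ioc 0 N, n.divisors.card : ℕ) : ℝ) ≤ N * (1 + Real.log N) := by
  have h := ArithmeticFunction.sum_Ioc_sigma0_eq_sum_div N
  simp only [ArithmeticFunction.sigma_zero_apply] at h
  calc ((∑ n ∈ Finset.Ioc 0 N, n.divisors.card : ℕ) : ℝ)
      = ∑ n ∈ Finset.Ioc 0 N, ((N / n : ℕ) : ℝ) := by rw [h]; push_cast; rfl
    _ ≤ ∑ n ∈ Finset.Ioc 0 N, N * (n : ℝ)⁻¹ :=
        Finset.sum_le_sum fun n _ => Nat.cast_div_le.trans_eq (div_eq_mul_inv _ _)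
    _ = N * (harmonic N : ℝ) := by
        rw [← Finset.mul_sum, harmonic_eq_sum_Icc]
        push_cast
        rfl
    _ ≤ N * (1 + Real.log N) := by gcongr; exact harmonic_le_one_add_log N

/-! ### Parameters that are not generic -/

namespace genPetersen

open Classical in
/-- A relation `x + k y = n m` with `|x|, |y| ≤ 8` forces `|m| ≤ 8` and determines `k`. -/
theorem card_not_generic_le (n : ℕ) :
    {k ∈ Finset.Icc 1 (n / 2) | ¬ Generic n k}.card ≤ 5000 := by
  let I : Finset ℤ := Finset.Icc (-8) 8
  have hsub : {k ∈ Finset.Icc 1 (n / 2) | ¬ Generic n k} ⊆ Finset.range 9 ∪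
      (I ×ˢ I ×ˢ I).image fun t : ℤ × ℤ × ℤ => (((n : ℤ) * t.2.2 - t.1) / t.2.1).toNat := by
    intro k hk
    simp only [Finset.mem_filter, Finset.mem_Icc, Generic, not_forall] at hk
    obtain ⟨⟨hk1, hk2⟩, x, y, hx, hy, hxy, h0⟩ := hk
    rw [Finset.mem_union, Finset.mem_range]
    by_cases hk9 : k < 9
    · exact Or.inl hk9
    right
    rw [ZMod.intCast_zmod_eq_zero_iff_dvd] at hxy
    obtain ⟨m, hm⟩ := hxy
    rw [abs_le] at hx hy
    have hn : 2 * (k : ℤ) ≤ n := by omega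
    have hk9' : (9 : ℤ) ≤ k := by omega
    have hm1 : m ≤ 8 := by
      by_contra! h
      nlinarith
    have hm2 : -8 ≤ m := by
      by_contra! h
      nlinarith
    have hy0 : y ≠ 0 := by
      rintro rfl
      refine h0 ⟨Int.eq_zero_of_abs_lt_dvd ⟨m, by simpa using hm⟩ ?_, rfl⟩
      rw [abs_lt]
      omega
    rw [Finset.mem_image]
    refine ⟨(x, y, m), ?_, ?_⟩
    · simp only [I, Finset.mem_product, Finset.mem_Icc]
      exact ⟨hx, hy, hm2, hm1⟩
    · simp only []
      rw [← hm, add_sub_cancel_left, Int.mul_ediv_cancel_left _ hy0, Int.toNat_natCast]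
  calc _ ≤ _ := Finset.card_le_card hsub
    _ ≤ _ := Finset.card_union_le _ _
    _ ≤ 9 + (I ×ˢ I ×ˢ I).card := by
      rw [Finset.card_range]
      exact Nat.add_le_add_left Finset.card_image_le 9
    -- The sum is `9 + 17 ^ 3`.
    _ ≤ 5000 := by simp [I, Finset.card_product]

end genPetersen

/-! ### Counting isomorphism classes -/

namespace PetersenParam

open genPetersen Classical

theorem pair_injective : Function.Injective fun p : PetersenParam => (p.n, p.k) := by
  rintro ⟨n, k, _, _, _⟩ ⟨n', k', _, _, _⟩ h
  simp only [Prod.mk.injEq] at h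
  obtain ⟨rfl, rfl⟩ := h
  rfl

theorem finite_n_le (N : ℕ) : {p : PetersenParam | p.n ≤ N}.Finite := by
  refine Set.Finite.of_finite_image (f := fun p => (p.n, p.k)) ?_ pair_injective.injOn
  refine ((Set.finite_Iic N).prod (Set.finite_Iic N)).subset ?_
  rintro _ ⟨p, hp, rfl⟩
  have h := p.two_mul_k_le
  simp only [Set.mem_ofPred_eq] at hp
  simp only [Set.mem_prod, Set.mem_Iic]
  omega

/-- The parameters with `n ≤ N`. -/
noncomputable def upTo (N : ℕ) : Finset PetersenParam := (finite_n_le N).toFinset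

theorem mem_upTo {N : ℕ} {p : PetersenParam} : p ∈ upTo N ↔ p.n ≤ N := by simp [upTo]

theorem petersenClasses_eq (N : ℕ) :
    petersenClasses N = ((upTo N).image fun p => (Quotient.mk _ p : Quotient isoSetoid)) := by
  simp [petersenClasses, upTo]

theorem n_eq_of_iso {p q : PetersenParam} (e : p.graph ≃g q.graph) : p.n = q.n := by
  have := Nat.card_congr e.toEquiv
  have := p.three_le_n
  have := q.three_le_n
  have : NeZero p.n := ⟨by omega⟩
  have : NeZero q.n := ⟨by omega⟩
  simp only [Nat.card_eq_fintype_card, Fintype.card_sum, ZMod.card] at *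
  omega

/-- Among generic parameters, the inner steps of the graphs isomorphic to `P(n, k)` lie in
`{±k, ±k⁻¹}` modulo `n`. -/
theorem card_iso_class_le (N : ℕ) (p : PetersenParam) (hp : Generic p.n p.k) :
    {q ∈ {q ∈ upTo N | Generic q.n q.k} |
      (Quotient.mk _ q : Quotient isoSetoid) = Quotient.mk _ p}.card ≤ 4 := by
  have hn := p.three_le_n
  have : NeZero p.n := ⟨by omega⟩
  have key : ∀ q : PetersenParam, Generic q.n q.k →
      (Quotient.mk _ q : Quotient isoSetoid) = Quotient.mk _ p →
      q.n = p.n ∧ ((q.k : ZMod p.n) ∈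
        ({(p.k : ZMod p.n), -(p.k : ZMod p.n), (p.k : ZMod p.n)⁻¹, -(p.k : ZMod p.n)⁻¹} :
          Finset (ZMod p.n))) := by
    intro q hq hqp
    have e : Nonempty (q.graph ≃g p.graph) := Quotient.exact hqp
    have hnn := n_eq_of_iso e.some
    refine ⟨hnn, ?_⟩
    obtain ⟨n, k, h3, h1, h2⟩ := p
    obtain ⟨n', l, h3', h1', h2'⟩ := q
    simp only at hnn hp hq this ⊢
    subst hnn
    have inv : ∀ x y : ZMod n', y * x = 1 → y = x⁻¹ := fun x y h => by
      have hu : IsUnit x := IsUnit.of_mul_eq_one_right _ h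
      calc y = y * (x * x⁻¹) := by rw [ZMod.mul_inv_of_unit _ hu, mul_one]
        _ = x⁻¹ := by rw [← mul_assoc, h, one_mul]
    simp only [Finset.mem_insert, Finset.mem_singleton]
    rcases step_of_nonempty_iso hq hp e with (h | h) | (h | h)
    · exact Or.inl h
    · exact Or.inr (Or.inl h)
    · exact Or.inr (Or.inr (Or.inl (inv _ _ h)))
    · refine Or.inr (Or.inr (Or.inr ?_))
      rw [← inv _ (-(l : ZMod n')) (by linear_combination -h), neg_neg]
  refine le_trans (Finset.card_le_card_of_injOn (t := {(p.k : ZMod p.n), -(p.k : ZMod p.n),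
    (p.k : ZMod p.n)⁻¹, -(p.k : ZMod p.n)⁻¹}) (fun q => (q.k : ZMod p.n)) (fun q hq => ?_) ?_)
    Finset.card_le_four
  · simp only [Finset.coe_filter, Finset.mem_filter, Set.mem_ofPred_eq] at hq
    exact (key q hq.1.2 hq.2).2
  · intro q hq r hr h
    simp only [Finset.coe_filter, Finset.mem_filter, Set.mem_ofPred_eq] at hq hr
    have hqn := (key q hq.1.2 hq.2).1
    have hrn := (key r hr.1.2 hr.2).1
    have := q.two_mul_k_le
    have := r.two_mul_k_le
    have := q.one_le_k
    have := r.one_le_k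
    have hqk : q.k < p.n := by omega
    have hrk : r.k < p.n := by omega
    refine pair_injective (Prod.ext (hqn.trans hrn.symm) ?_)
    exact Nat.ModEq.eq_of_lt_of_lt ((ZMod.natCast_eq_natCast_iff _ _ _).1 h) hqk hrk

/-- The inner steps that are not generic, or that satisfy the condition on the inner steps of
generic Cayley graphs. -/
noncomputable def exceptional (n : ℕ) : Finset ℕ :=
  {k ∈ Finset.Icc 1 (n / 2) | ¬ Generic n k} ∪
    ({k ∈ Finset.range n | ((k : ℕ) : ZMod n) ^ 2 = 1} ∪
      {k ∈ Finset.range n | ((k : ℕ) : ZMod n) ^ 2 = -1})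

theorem card_exceptional_le {n : ℕ} (hn : 0 < n) :
    (exceptional n).card ≤ 5000 + 4 * n.divisors.card := by
  have h1 := card_not_generic_le n
  have h2 := card_sq_eq_one_le hn
  have h3 := card_sq_eq_neg_one_le hn
  refine (Finset.card_union_le _ _).trans (Nat.add_le_add h1 ?_)
  refine (Finset.card_union_le _ _).trans ?_
  omega

theorem k_mem_exceptional {p : PetersenParam} (h : IsCayleyGraph p.graph) :
    p.k ∈ exceptional p.n := by
  have h1 := p.one_le_k
  have h2 := p.two_mul_k_le
  have : NeZero p.n := ⟨by omega⟩
  simp only [exceptional, Finset.mem_union, Finset.mem_filter, Finset.mem_Icc, Finset.mem_range]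
  by_cases hg : Generic p.n p.k
  · exact Or.inr ((sq_of_isCayleyGraph hg h).imp (fun h => ⟨by omega, h⟩) fun h => ⟨by omega, h⟩)
  · exact Or.inl ⟨⟨h1, by omega⟩, hg⟩

theorem cayleyPetersenCount_le (N : ℕ) :
    cayleyPetersenCount N ≤ 5000 * N + 4 * ∑ n ∈ Finset.Ioc 0 N, n.divisors.card := by
  have hfin : {p : PetersenParam | p.n ≤ N ∧ IsCayleyGraph p.graph}.Finite :=
    (finite_n_le N).subset fun p hp => hp.1
  calc cayleyPetersenCount N ≤ {p : PetersenParam | p.n ≤ N ∧ IsCayleyGraph p.graph}.ncard :=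
        Set.ncard_image_le hfin
    _ ≤ (((Finset.Ioc 0 N).sigma exceptional : Finset (Σ _ : ℕ, ℕ)) : Set (Σ _ : ℕ, ℕ)).ncard := by
        refine Set.ncard_le_ncard_of_injOn (fun p => ⟨p.n, p.k⟩) ?_ ?_ (Finset.finite_toSet _)
        · intro p hp
          have := p.three_le_n
          simp only [Finset.mem_coe, Finset.mem_sigma, Finset.mem_Ioc]
          exact ⟨⟨by omega, hp.1⟩, k_mem_exceptional hp.2⟩
        · intro p _ q _ h
          simp only [Sigma.mk.injEq, heq_eq_eq] at h
          exact pair_injective (Prod.ext h.1 h.2)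
    _ = ∑ n ∈ Finset.Ioc 0 N, (exceptional n).card := by
        rw [Set.ncard_coe_finset, Finset.card_sigma]
    _ ≤ ∑ n ∈ Finset.Ioc 0 N, (5000 + 4 * n.divisors.card) :=
        Finset.sum_le_sum fun n hn => card_exceptional_le (Finset.mem_Ioc.1 hn).1
    _ = _ := by
        rw [Finset.sum_add_distrib, Finset.mul_sum]
        simp [mul_comm]

theorem card_not_generic_upTo_le (N : ℕ) :
    {p ∈ upTo N | ¬ Generic p.n p.k}.card ≤ 5000 * N := by
  calc {p ∈ upTo N | ¬ Generic p.n p.k}.card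
      ≤ ((Finset.Ioc 0 N).sigma fun n => {k ∈ Finset.Icc 1 (n / 2) | ¬ Generic n k}).card := by
        refine Finset.card_le_card_of_injOn (fun p => ⟨p.n, p.k⟩) ?_ ?_
        · intro p hp
          have := p.three_le_n
          have := p.one_le_k
          have := p.two_mul_k_le
          simp only [Finset.coe_filter, mem_upTo, Set.mem_ofPred_eq] at hp
          simp only [Finset.mem_coe, Finset.mem_sigma, Finset.mem_Ioc, Finset.mem_filter,
            Finset.mem_Icc]
          exact ⟨⟨by omega, hp.1⟩, ⟨by omega, by omega⟩, hp.2⟩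
        · intro p _ q _ h
          simp only [Sigma.mk.injEq, heq_eq_eq] at h
          exact pair_injective (Prod.ext h.1 h.2)
    _ = ∑ n ∈ Finset.Ioc 0 N, {k ∈ Finset.Icc 1 (n / 2) | ¬ Generic n k}.card :=
        Finset.card_sigma _ _
    _ ≤ ∑ n ∈ Finset.Ioc 0 N, 5000 := Finset.sum_le_sum fun n _ => card_not_generic_le n
    _ = 5000 * N := by simp [mul_comm]

/-- The pairs with `3N/4 < n ≤ N` and `1 ≤ k ≤ N/4` are parameters. -/
theorem sq_le_card_upTo (N : ℕ) : (N / 4) * (N / 4) ≤ (upTo N).card := by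
  have h : Finset.Ioc (N - N / 4) N ×ˢ Finset.Icc 1 (N / 4) ⊆
      (upTo N).image fun p => (p.n, p.k) := by
    rintro ⟨n, k⟩ h
    simp only [Finset.mem_product, Finset.mem_Ioc, Finset.mem_Icc] at h
    rw [Finset.mem_image]
    exact ⟨⟨n, k, by omega, by omega, by omega⟩, mem_upTo.2 h.1.2, rfl⟩
  have h1 := (Finset.card_le_card h).trans Finset.card_image_le
  rw [Finset.card_product, Nat.card_Ioc, Nat.card_Icc] at h1
  rwa [show N - (N - N / 4) = N / 4 by omega, Nat.add_sub_cancel] at h1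

theorem sq_le_petersenCount (N : ℕ) :
    (N / 4) * (N / 4) ≤ 4 * petersenCount N + 5000 * N := by
  have h1 : {q ∈ upTo N | Generic q.n q.k}.card ≤ 4 * petersenCount N := by
    refine (Finset.card_le_mul_card_image (f := fun p => (Quotient.mk _ p : Quotient isoSetoid))
      _ 4 ?_).trans (Nat.mul_le_mul_left 4 ?_)
    · intro c hc
      obtain ⟨p, hp, rfl⟩ := Finset.mem_image.1 hc
      exact card_iso_class_le N p (Finset.mem_filter.1 hp).2
    · rw [petersenCount, petersenClasses_eq, Set.ncard_coe_finset]
      exact Finset.card_le_card (Finset.image_subset_image (Finset.filter_subset _ _))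
  have h2 := card_not_generic_upTo_le N
  have h3 := sq_le_card_upTo N
  have h4 := Finset.card_filter_add_card_filter_not (s := upTo N) fun q => Generic q.n q.k
  omega

end PetersenParam

/-! ### Asymptotics -/

theorem eventually_ratio_lt :
    ∀ᶠ N : ℕ in atTop,
      (cayleyPetersenCount N : ℝ) / (petersenCount N : ℝ) < 1000000 * (Real.log N / N) := by
  filter_upwards [eventually_ge_atTop 1000000] with N hN
  have hN' : (1000000 : ℝ) ≤ N := by exact_mod_cast hN
  have hlog : 1 ≤ Real.log N := by
    rw [Real.le_log_iff_exp_le (by linarith)]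
    linarith [Real.exp_one_lt_d9]
  have hB : (cayleyPetersenCount N : ℝ) ≤ 6000 * N * Real.log N := by
    have h1 : (cayleyPetersenCount N : ℝ) ≤
        5000 * N + 4 * ((∑ n ∈ Finset.Ioc 0 N, n.divisors.card : ℕ) : ℝ) := by
      exact_mod_cast PetersenParam.cayleyPetersenCount_le N
    have h2 := sum_card_divisors_le N
    nlinarith
  have hA : (N : ℝ) ^ 2 / 100 ≤ petersenCount N := by
    have h1 : ((N / 4 : ℕ) : ℝ) * ((N / 4 : ℕ) : ℝ) ≤ 4 * (petersenCount N : ℝ) + 5000 * N := by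
      exact_mod_cast PetersenParam.sq_le_petersenCount N
    have h2 : (N : ℝ) / 4 - 1 ≤ ((N / 4 : ℕ) : ℝ) := by
      have : N ≤ 4 * (N / 4) + 4 := by omega
      have : (N : ℝ) ≤ 4 * ((N / 4 : ℕ) : ℝ) + 4 := by exact_mod_cast this
      linarith
    nlinarith
  have hpos : (0 : ℝ) < N := by linarith
  calc (cayleyPetersenCount N : ℝ) / (petersenCount N : ℝ)
      ≤ (6000 * N * Real.log N) / ((N : ℝ) ^ 2 / 100) := by gcongr
    _ = 600000 * (Real.log N / N) := by field_simp; ring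
    _ < 1000000 * (Real.log N / N) := by
        have : 0 < Real.log N / N := by positivity
        linarith

theorem theorem2 :
    Tendsto (fun N : ℕ => (cayleyPetersenCount N : ℝ) / (petersenCount N : ℝ)) atTop (𝓝 0) ∧
    ∃ c : ℝ, 0 < c ∧ ∀ᶠ N : ℕ in atTop,
      (cayleyPetersenCount N : ℝ) / (petersenCount N : ℝ) < c * (Real.log N / N) := by
  refine ⟨?_, 1000000, by norm_num, eventually_ratio_lt⟩
  have hlog : Tendsto (fun N : ℕ => 1000000 * (Real.log N / N)) atTop (𝓝 0) := by
    simpa using (Real.isLittleO_log_id_atTop.tendsto_div_nhds_zero.comp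
      tendsto_natCast_atTop_atTop).const_mul (1000000 : ℝ)
  exact tendsto_of_tendsto_of_tendsto_of_le_of_le' tendsto_const_nhds hlog
    (Eventually.of_forall fun N => by positivity) (eventually_ratio_lt.mono fun N h => h.le)
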